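/- Let $m\ge 2$ and $t\ge s\ge 1$ be integers, let $\mathcal A=\{0,1,\dots,m-1\}$, and let $\varphi$ be the substitution on $\mathcal A^*$ given by $\varphi(a)=0^t(a+1)$ for $0\le a\le m-2$ and $\varphi(m-1)=0^s$. Let $u_\beta=\lim_{n\to\infty}\varphi^n(0)$ be its unique right infinite fixed point. For a left infinite word $v=\cdots v_3v_2v_1$ over $\mathcal A$ write $\widetilde v=v_1v_2v_3\cdots$; the two-sided infinite word $v\widetilde v$ is called an infinite palindromic branch of $u_\beta$ with center $\varepsilon$ (the empty word) if, for every $n\ge 1$, the palindrome $v_n\cdots v_1v_1\cdots v_n$ is a factor of $u_\beta$. A morphism $\psi$ acts on a left infinite word by $\psi(\cdots v_3v_2v_1)=\cdots\psi(v_3)\psi(v_2)\psi(v_1)$ and on a pointed two-sided infinite word by $\psi(\cdots x_{-2}x_{-1}|x_0x_1\cdots)=\cdots\psi(x_{-2})\psi(x_{-1})|\psi(x_0)\psi(x_1)\cdots$. A substitution is a morphism $\psi$ with all $\psi(a)$ non-empty and with $\psi(a)=ax$ for some letter $a$ and some non-empty word $x$. If a word $x$ is a prefix of a word $y$, then $x^{-1}y$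 denotes the word $z$ with $y=xz$. **Theorem.** Suppose that $t$ is even, or that $t$ and $s$ are both odd. Then $u_\beta$ has exactly one infinite palindromic branch $v\widetilde v$ with center $\varepsilon$, and the left infinite word $v$ is invariant under the substitution $\psi$, that is, $\psi(v)=v$, where for all $a\in\mathcal A$ $$ \psi(a)=\begin{cases} w^{-1}\varphi(a)w, & \text{with } w=0^{t/2}, \text{ if } t \text{ is even},\\ w^{-1}\varphi^{m+1}(a)w, & \text{with } w=\varphi^m\bigl(0^{(t+1)/2}\bigr)0^{(t-s)/2}, \text{ if } t \text{ and } s \text{ are odd}; \end{cases} $$ here $w$ is a prefix of $\varphi(a)w$, respectively of $\varphi^{m+1}(a)w$, for every $a\in\mathcal A$, so that $\psi$ is well defined, and $\psi$ is a substitution. Moreover, if $t$ is even, then $\psi(a)$ is a palindrome for every $a\in\mathcal A$, and the pointed two-sided infinite word $v|\widetilde v$ is invariant under $\psi$. -/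

import Mathlib

namespace PalBranch

variable {A : Type*}

/-- A right infinite word `u_0 u_1 u_2 ⋯`; the letter `u_n` is `u n`. -/
abbrev RightWord (A : Type*) := ℕ → A

/-- A left infinite word `⋯ v_3 v_2 v_1`; the letter `v_(n+1)` is `v n`, so that letters are
counted from the right end. -/
abbrev LeftWord (A : Type*) := ℕ → A

/-- A pointed two-sided infinite word `⋯ u_(-2) u_(-1) | u_0 u_1 ⋯`. -/
abbrev PointedWord (A : Type*) := ℤ → A

/-- A morphism of the free monoid over `A`, given by the images of the letters. -/
abbrev Morphism (A : Type*) := A → List A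

/-- The factor `u_i u_(i+1) ⋯ u_(i+n-1)` of a right infinite word. -/
def RightWord.factor (u : RightWord A) (i n : ℕ) : List A :=
  (List.range n).map fun k => u (i + k)

/-- The prefix `u_0 ⋯ u_(n-1)` of length `n` of a right infinite word. -/
def RightWord.pre (u : RightWord A) (n : ℕ) : List A := (List.range n).map u

/-- The suffix `v_n ⋯ v_1` of length `n` of a left infinite word. -/
def LeftWord.suf (v : LeftWord A) (n : ℕ) : List A := ((List.range n).map v).reverse

/-- The reversal `v_1 v_2 v_3 ⋯` of the left infinite word `⋯ v_3 v_2 v_1`. -/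
def LeftWord.reversal (v : LeftWord A) : RightWord A := fun n => v n

/-- The pointed two-sided infinite word `⋯ v_2 v_1 | x_0 x_1 ⋯`. -/
def pointed (v : LeftWord A) (x : RightWord A) : PointedWord A
  | Int.ofNat n => x n
  | Int.negSucc n => v n

/-- The part of a pointed word to the left of the point. -/
def PointedWord.left (u : PointedWord A) : LeftWord A := fun n => u (Int.negSucc n)

/-- The part of a pointed word to the right of the point. -/
def PointedWord.right (u : PointedWord A) : RightWord A := fun n => u (Int.ofNat n)

/-- The language of a right infinite word: the set of its finite factors. -/
def language (u : RightWord A) : Set (List A) := {w | ∃ i n, w = u.factor i n}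

/-- A finite word is a palindrome if it equals its reversal. -/
def IsPal (p : List A) : Prop := p.reverse = p

/-- The palindromes in the language of `u`. -/
def pal (u : RightWord A) : Set (List A) := {p | p ∈ language u ∧ IsPal p}

/-- The action of a morphism on finite words. -/
def Morphism.onWord (φ : Morphism A) (w : List A) : List A := w.flatMap φ

/-- The action `φ ^ k` of the `k`-th iterate of a morphism on finite words. -/
def Morphism.iter (φ : Morphism A) (k : ℕ) (w : List A) : List A := φ.onWord^[k] w

/-- A substitution: a non-erasing morphism `φ` such that `φ(a) = a w` for some letter `a` and some
non-empty word `w`. -/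
def IsSubstitution (φ : Morphism A) : Prop :=
  (∀ a, φ a ≠ []) ∧ ∃ a w, w ≠ [] ∧ φ a = a :: w

/-- The concatenation `φ(u_0) φ(u_1) φ(u_2) ⋯` is infinite and equal to the right infinite
word `x`. -/
def IsImageRight (φ : Morphism A) (u x : RightWord A) : Prop :=
  (∀ n, φ.onWord (u.pre n) = x.pre (φ.onWord (u.pre n)).length) ∧
    ∀ N, ∃ n, N ≤ (φ.onWord (u.pre n)).length

/-- The concatenation `⋯ φ(v_3) φ(v_2) φ(v_1)` is infinite and equal to the left infinite
word `x`. -/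
def IsImageLeft (φ : Morphism A) (v x : LeftWord A) : Prop :=
  (∀ n, φ.onWord (v.suf n) = x.suf (φ.onWord (v.suf n)).length) ∧
    ∀ N, ∃ n, N ≤ (φ.onWord (v.suf n)).length

/-- The pointed word `⋯ φ(u_(-2)) φ(u_(-1)) | φ(u_0) φ(u_1) ⋯` equals `x`. -/
def IsImagePointed (φ : Morphism A) (u x : PointedWord A) : Prop :=
  IsImageLeft φ u.left x.left ∧ IsImageRight φ u.right x.right

/-- The two-sided word `⋯ v_2 v_1 v_1 v_2 ⋯` is an infinite palindromic branch of `u` whose center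
is the empty word. -/
def IsEmptyCenterBranch (u : RightWord A) (v : LeftWord A) : Prop :=
  ∀ n, 1 ≤ n → v.suf n ++ v.reversal.pre n ∈ pal u

/-- The word `x⁻¹ y`, which is meaningful if `x` is a prefix of `y`. -/
def leftQuot (x y : List A) : List A := y.drop x.length

/-- The substitution `a ↦ 0^t (a+1)` for `a ≠ m - 1`, and `m - 1 ↦ 0^s`, over the
alphabet `{0, …, m - 1}`. -/
def phi (m t s : ℕ) [NeZero m] : Morphism (Fin m) := fun a =>
  if h : (a : ℕ) + 1 < m then List.replicate t 0 ++ [⟨a + 1, h⟩] else List.replicate s 0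

/-- The right infinite word `lim φ^n(0)`: for `m ≥ 2` and `t, s ≥ 1`, the word `φ^n(0)` has length
greater than `n` and is a prefix of `φ^(n+1)(0)`. -/
def uBeta (m t s : ℕ) [NeZero m] : RightWord (Fin m) := fun n =>
  ((phi m t s).iter n [0]).getD n 0

section helpers

theorem onWord_append (φ : Morphism A) (x y : List A) :
    φ.onWord (x ++ y) = φ.onWord x ++ φ.onWord y := by
  simp [Morphism.onWord]

theorem iter_append (φ : Morphism A) (k : ℕ) (x y : List A) :
    φ.iter k (x ++ y) = φ.iter k x ++ φ.iter k y := by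
  induction k generalizing x y with
  | zero => rfl
  | succ k ih =>
    simp only [Morphism.iter, Function.iterate_succ_apply] at ih ⊢
    rw [onWord_append, ih]

theorem iter_succ (φ : Morphism A) (k : ℕ) (x : List A) :
    φ.iter (k + 1) x = φ.onWord (φ.iter k x) := by
  simp only [Morphism.iter, Function.iterate_succ_apply']

theorem length_le_onWord {φ : Morphism A} (h : ∀ a, φ a ≠ []) (x : List A) :
    x.length ≤ (φ.onWord x).length := by
  induction x with
  | nil => simp
  | cons a x ih =>
    have h1 : 1 ≤ (φ a).length := List.length_pos_iff.2 (h a)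
    simp only [Morphism.onWord, List.flatMap_cons, List.length_append, List.length_cons] at ih ⊢
    omega

theorem length_le_iter {φ : Morphism A} (h : ∀ a, φ a ≠ []) (k : ℕ) (x : List A) :
    x.length ≤ (φ.iter k x).length := by
  induction k with
  | zero => exact le_rfl
  | succ k ih => rw [iter_succ]; exact ih.trans (length_le_onWord h _)

theorem pre_length (u : RightWord A) (n : ℕ) : (u.pre n).length = n := by
  simp [RightWord.pre]

theorem eq_pre_of_append {u : RightWord A} {x y : List A} {n : ℕ} (h : x ++ y = u.pre n) :
    x = u.pre x.length := by
  have hl : x.length + y.length = n := by rw [← pre_length u n, ← h, List.length_append]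
  have h2 : (x ++ y).take x.length = (u.pre n).take x.length := by rw [h]
  rw [List.take_left' rfl] at h2
  have h3 : min x.length n = x.length := by omega
  rw [RightWord.pre, ← List.map_take, List.take_range, h3] at h2
  exact h2

variable {m t s : ℕ} [NeZero m]

theorem phi_ne_nil (hs : 1 ≤ s) (a : Fin m) : phi m t s a ≠ [] := by
  unfold phi
  split
  · simp
  · rw [ne_eq, List.replicate_eq_nil_iff]; omega

theorem phi_zero (hm : 2 ≤ m) (ht : 1 ≤ t) : ∃ y, y ≠ [] ∧ phi m t s 0 = 0 :: y := by
  obtain ⟨r, rfl⟩ : ∃ r, t = r + 1 := ⟨t - 1, by omega⟩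
  have h : ((0 : Fin m) : ℕ) + 1 < m := by simp; omega
  refine ⟨List.replicate r 0 ++ [⟨_, h⟩], by simp, ?_⟩
  rw [phi, dif_pos h, List.replicate_succ, List.cons_append]

theorem iter_zero_prefix (hm : 2 ≤ m) (ht : 1 ≤ t) (hs : 1 ≤ s) (n : ℕ) :
    ∃ y, y ≠ [] ∧ (phi m t s).iter (n + 1) [0] = (phi m t s).iter n [0] ++ y := by
  obtain ⟨y, hy, h⟩ := phi_zero (s := s) hm ht
  refine ⟨(phi m t s).iter n y, ?_, ?_⟩
  · rw [← List.length_pos_iff] at hy ⊢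
    exact lt_of_lt_of_le hy (length_le_iter (phi_ne_nil hs) n y)
  · rw [← iter_append]
    simp only [Morphism.iter, Function.iterate_succ_apply]
    congr 1
    simp [Morphism.onWord, h]

theorem iter_zero_prefix_le (hm : 2 ≤ m) (ht : 1 ≤ t) (hs : 1 ≤ s) {k n : ℕ} (h : k ≤ n) :
    (phi m t s).iter k [0] <+: (phi m t s).iter n [0] := by
  induction n, h using Nat.le_induction with
  | base => exact List.prefix_rfl
  | succ n _ ih =>
    obtain ⟨y, -, h⟩ := iter_zero_prefix (s := s) hm ht hs n
    exact ih.trans ⟨y, h.symm⟩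

theorem lt_length_iter_zero (hm : 2 ≤ m) (ht : 1 ≤ t) (hs : 1 ≤ s) (n : ℕ) :
    n < ((phi m t s).iter n [0]).length := by
  induction n with
  | zero => simp [Morphism.iter]
  | succ n ih =>
    obtain ⟨y, hy, h⟩ := iter_zero_prefix (s := s) hm ht hs n
    rw [← List.length_pos_iff] at hy
    rw [h, List.length_append]
    omega

/-- Every `φ^n(0)` is a prefix of `uBeta`. -/
theorem iter_zero_eq_pre (hm : 2 ≤ m) (ht : 1 ≤ t) (hs : 1 ≤ s) (n : ℕ) :
    (phi m t s).iter n [0] = (uBeta m t s).pre ((phi m t s).iter n [0]).length := by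
  refine List.ext_getElem (pre_length _ _).symm fun i h1 h2 => ?_
  have h3 := lt_length_iter_zero (s := s) hm ht hs i
  simp only [RightWord.pre, List.getElem_map, List.getElem_range, uBeta]
  rw [List.getD_eq_getElem _ _ h3]
  rcases le_total i n with h | h
  · exact ((iter_zero_prefix_le hm ht hs h).getElem h3).symm
  · exact (iter_zero_prefix_le hm ht hs h).getElem h1

/-- The word `uBeta` is a fixed point of `phi`. -/
theorem uBeta_fixed (hm : 2 ≤ m) (ht : 1 ≤ t) (hs : 1 ≤ s) :
    IsImageRight (phi m t s) (uBeta m t s) (uBeta m t s) := by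
  refine ⟨fun n => ?_, fun N => ⟨N, ?_⟩⟩
  · have h1 := lt_length_iter_zero (s := s) hm ht hs n
    have h2 := iter_zero_eq_pre (s := s) hm ht hs n
    have h3 : (phi m t s).iter n [0] = (uBeta m t s).pre n ++ ((phi m t s).iter n [0]).drop n := by
      conv_lhs => rw [← List.take_append_drop n ((phi m t s).iter n [0])]
      congr 1
      rw [h2, RightWord.pre, ← List.map_take, List.take_range, RightWord.pre]
      congr 2
      omega
    have h4 := iter_zero_eq_pre (s := s) hm ht hs (n + 1)
    rw [iter_succ] at h4
    nth_rw 1 [h3] at h4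
    rw [onWord_append] at h4
    exact eq_pre_of_append h4
  · have := length_le_onWord (phi_ne_nil (m := m) (t := t) hs) ((uBeta m t s).pre N)
    rwa [pre_length] at this

/-- The word `uBeta` is the only fixed point of `phi`. -/
theorem uBeta_unique (hm : 2 ≤ m) (ht : 1 ≤ t) (hs : 1 ≤ s) (u : RightWord (Fin m))
    (hu : IsImageRight (phi m t s) u u) : u = uBeta m t s := by
  have key : ∀ n, (phi m t s).iter n [0] = u.pre ((phi m t s).iter n [0]).length := by
    intro n
    induction n with
    | zero =>
      have h1 := hu.1 1
      have h2 : ∃ y, phi m t s (u 0) = 0 :: y := by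
        unfold phi
        split
        · obtain ⟨r, rfl⟩ : ∃ r, t = r + 1 := ⟨t - 1, by omega⟩
          exact ⟨_, by rw [List.replicate_succ, List.cons_append]⟩
        · obtain ⟨r, rfl⟩ : ∃ r, s = r + 1 := ⟨s - 1, by omega⟩
          exact ⟨_, by rw [List.replicate_succ]⟩
      obtain ⟨y, hy⟩ := h2
      have h3 : (phi m t s).onWord (u.pre 1) = [0] ++ y := by
        simp [RightWord.pre, Morphism.onWord, hy]
      rw [h3] at h1
      exact eq_pre_of_append h1
    | succ n ih =>
      rw [iter_succ, ih]
      exact hu.1 _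
  funext k
  have h1 := lt_length_iter_zero (s := s) hm ht hs k
  have h2 := (key k).symm.trans (iter_zero_eq_pre hm ht hs k)
  simp only [RightWord.pre, List.map_inj_left, List.mem_range] at h2
  exact h2 k h1

end helpers

end PalBranch

namespace PalBranch

/-! ### Words, languages and limits over an arbitrary alphabet -/

section general

variable {A : Type*}

/-! Write φ for `phi`, and φ_j for the conjugate of φ by 0^j, so φ(x)0^j = 0^j φ_j(x). For j = t
this conjugate is the mirror image of φ, hence φ(x~)0^t = 0^t φ(x)~ with ~ the reversal. Therefore
φ(x d x~)0^t = φ(x) · φ(d)0^t · φ(x)~, and if φ(d)0^t = 0^j e 0^j, a palindrome with center d yields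
the palindrome φ_j(x) e φ_j(x)~ with center e (`CenterStep.lift`). Conversely, a long palindrome
with center e can be cut next to its outermost non-zero letters. What lies between is φ(Q)0^t for a
palindrome Q, so every long palindrome arises by such a step (`exists_desubstitution`).

The steps between centers are few: ε → ε (t even, j = t/2), ε → 0 (t odd, j = (t-1)/2), a → a+1 (j =
t), and m-1 → ε or m-1 → 0 according to the parity of s+t. Going back from ε: - For t even, the only
predecessor that matters is ε. If s is even too, m-1 also precedes ε, but the chain m-1, m-2, …, 0
then stops, so palindromes with these centers are bounded. - For t and s odd, the only way back is
the cycle ε → 0 → 1 → ⋯ → m-1 → ε of m+1 steps.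

Composing the φ_j along the loop at ε gives ψ, which is φ or φ^(m+1) conjugated by w. Half of any
sufficiently long even palindrome then ends with ψ^k(0). Since ψ(0) ends with 0, these words form a
chain of suffixes whose limit is the only branch and is fixed by ψ
(`existsUnique_branch_of_desubstitution`). -/

theorem pre_add (u : RightWord A) (i n : ℕ) : u.pre (i + n) = u.pre i ++ u.factor i n := by
  simp [RightWord.pre, RightWord.factor, List.range_add, Function.comp_def]

theorem pre_prefix (u : RightWord A) {i n : ℕ} (h : i ≤ n) : u.pre i <+: u.pre n := by
  obtain ⟨k, rfl⟩ := Nat.exists_eq_add_of_le h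
  exact ⟨_, (pre_add u i k).symm⟩

theorem eq_pre_of_prefix {u : RightWord A} {x : List A} {n : ℕ} (h : x <+: u.pre n) :
    x = u.pre x.length := by
  obtain ⟨y, h⟩ := h
  exact eq_pre_of_append h

theorem mem_language_iff (u : RightWord A) (z : List A) :
    z ∈ language u ↔ ∃ n, z <:+: u.pre n := by
  constructor
  · rintro ⟨i, n, rfl⟩
    refine ⟨i + n, ?_⟩
    rw [pre_add]
    exact (List.suffix_append _ _).isInfix
  · rintro ⟨n, x, y, h⟩
    have h1 := eq_pre_of_append h
    rw [List.length_append, pre_add] at h1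
    exact ⟨_, _, List.append_inj_right h1 (pre_length _ _).symm⟩

theorem mem_language_of_infix {u : RightWord A} {x y : List A} (h : x <:+: y)
    (hy : y ∈ language u) : x ∈ language u := by
  rw [mem_language_iff] at hy ⊢
  obtain ⟨n, hn⟩ := hy
  exact ⟨n, h.trans hn⟩

theorem exists_append_mem_language {u : RightWord A} {x : List A} (h : x ∈ language u) :
    ∃ a b, x ++ [a, b] ∈ language u := by
  obtain ⟨i, n, rfl⟩ := h
  refine ⟨u (i + n), u (i + (n + 1)), i, n + 2, ?_⟩
  simp [RightWord.factor, List.range_succ]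

theorem suf_eq_reverse_pre (v : LeftWord A) (n : ℕ) :
    v.suf n = (RightWord.pre v n).reverse := rfl

theorem suf_length (v : LeftWord A) (n : ℕ) : (v.suf n).length = n := by
  simp [LeftWord.suf]

theorem suf_suffix (v : LeftWord A) {i n : ℕ} (h : i ≤ n) : v.suf i <:+ v.suf n :=
  List.reverse_suffix.2 (pre_prefix v h)

theorem eq_suf_of_suffix {v : LeftWord A} {x : List A} {n : ℕ} (h : x <:+ v.suf n) :
    x = v.suf x.length := by
  have h1 : x.reverse <+: RightWord.pre v n := by
    rw [← List.reverse_suffix, List.reverse_reverse]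
    exact h
  have h2 := eq_pre_of_prefix h1
  rw [suf_eq_reverse_pre, ← List.length_reverse, ← h2, List.reverse_reverse]

theorem suf_append_reversal_pre (v : LeftWord A) (n : ℕ) :
    v.suf n ++ v.reversal.pre n = v.suf n ++ (v.suf n).reverse := by
  rw [suf_eq_reverse_pre, List.reverse_reverse]
  rfl

theorem onWord_nil (φ : Morphism A) : φ.onWord [] = [] := rfl

theorem onWord_singleton (φ : Morphism A) (a : A) : φ.onWord [a] = φ a := by
  simp [Morphism.onWord]

theorem onWord_cons (φ : Morphism A) (a : A) (x : List A) :
    φ.onWord (a :: x) = φ a ++ φ.onWord x := by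
  simp [Morphism.onWord]

theorem onWord_suffix (φ : Morphism A) {x y : List A} (h : x <:+ y) :
    φ.onWord x <:+ φ.onWord y := by
  obtain ⟨z, rfl⟩ := h
  rw [onWord_append]
  exact List.suffix_append _ _

theorem onWord_infix (φ : Morphism A) {x y : List A} (h : x <:+: y) :
    φ.onWord x <:+: φ.onWord y := by
  obtain ⟨z, w, rfl⟩ := h
  rw [onWord_append, onWord_append]
  exact ⟨_, _, rfl⟩

theorem onWord_reverse {φ ψ : Morphism A} (h : ∀ a, (φ a).reverse = ψ a) (x : List A) :
    (φ.onWord x).reverse = ψ.onWord x.reverse := by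
  induction x with
  | nil => rfl
  | cons a x ih =>
    rw [onWord_cons, List.reverse_append, ih, List.reverse_cons, onWord_append,
      onWord_singleton, h]

theorem onWord_conj {φ ψ : Morphism A} {w : List A} (h : ∀ a, φ a ++ w = w ++ ψ a)
    (x : List A) : φ.onWord x ++ w = w ++ ψ.onWord x := by
  induction x with
  | nil => simp [onWord_nil]
  | cons a x ih =>
    rw [onWord_cons, onWord_cons, List.append_assoc, ih, ← List.append_assoc, h,
      List.append_assoc]

theorem iter_zero (φ : Morphism A) (x : List A) : φ.iter 0 x = x := rfl

theorem iter_ne_nil {φ : Morphism A} (h : ∀ a, φ a ≠ []) (k : ℕ) {x : List A} (hx : x ≠ []) :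
    φ.iter k x ≠ [] := by
  rw [← List.length_pos_iff] at hx ⊢
  exact lt_of_lt_of_le hx (length_le_iter h k x)

/-- A chain of words, each a prefix of the next one, with lengths tending to infinity, has a
limit. -/
theorem exists_limit [Inhabited A] (S : ℕ → List A) (h : ∀ k, S k <+: S (k + 1))
    (hl : ∀ k, k < (S k).length) : ∃ v : RightWord A, ∀ k, S k = v.pre (S k).length := by
  have hle : ∀ {k n}, k ≤ n → S k <+: S n := by
    intro k n hkn
    induction n, hkn using Nat.le_induction with
    | base => exact List.prefix_rfl
    | succ n _ ih => exact ih.trans (h n)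
  -- The default is never read, since `n < (S n).length`.
  refine ⟨fun n => (S n).getD n default, fun k => ?_⟩
  refine List.ext_getElem (pre_length _ _).symm fun i h1 h2 => ?_
  simp only [RightWord.pre, List.getElem_map, List.getElem_range]
  rw [List.getD_eq_getElem _ _ (hl i)]
  rcases le_total i k with hik | hik
  · exact ((hle hik).getElem (hl i)).symm
  · exact (hle hik).getElem h1

theorem palindrome_decomp {x : List A} (h : x.reverse = x) :
    ∃ y d, d.length ≤ 1 ∧ x = y ++ d ++ y.reverse := by
  induction List.Palindrome.of_reverse_eq h with
  | nil => exact ⟨[], [], by simp, rfl⟩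
  | singleton a => exact ⟨[], [a], by simp, rfl⟩
  | @cons_concat a l hl ih =>
    obtain ⟨y, d, hd, rfl⟩ := ih hl.reverse_eq
    exact ⟨a :: y, d, hd, by simp⟩

theorem center_of_eq {z e y f : List A} (h : z ++ e ++ z.reverse = y ++ f ++ y.reverse)
    (hef : e.length ≤ f.length) : ∃ g, z = y ++ g ∧ f = g ++ e ++ g.reverse := by
  have hl := congrArg List.length h
  simp only [List.length_append, List.length_reverse] at hl
  have h1 : y <+: y ++ f ++ y.reverse := ⟨f ++ y.reverse, by simp⟩
  have h2 : z <+: y ++ f ++ y.reverse := ⟨e ++ z.reverse, by simp [← h]⟩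
  obtain ⟨g, rfl⟩ := List.prefix_of_prefix_length_le h1 h2 (by omega)
  refine ⟨g, rfl, ?_⟩
  have h3 : y ++ (g ++ e ++ g.reverse ++ y.reverse) = y ++ (f ++ y.reverse) := by
    simpa using h
  exact (List.append_cancel_right (List.append_cancel_left h3)).symm

theorem eq_replicate_or_exists_left [DecidableEq A] (o : A) (z : List A) :
    z = List.replicate z.length o ∨ ∃ i c z', c ≠ o ∧ z = List.replicate i o ++ c :: z' := by
  induction z with
  | nil => exact Or.inl rfl
  | cons a z ih =>
    by_cases ha : a = o
    · subst ha
      rcases ih with ih | ⟨i, c, z', hc, ih⟩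
      · left
        rw [List.length_cons, List.replicate_succ, ← ih]
      · exact Or.inr ⟨i + 1, c, z', hc, by rw [ih]; rfl⟩
    · exact Or.inr ⟨0, a, z, ha, rfl⟩

theorem eq_replicate_or_exists_right [DecidableEq A] (o : A) (z : List A) :
    z = List.replicate z.length o ∨ ∃ i c z', c ≠ o ∧ z = z' ++ c :: List.replicate i o := by
  rcases eq_replicate_or_exists_left o z.reverse with h | ⟨i, c, z', hc, h⟩
  · left
    rw [List.length_reverse] at h
    rw [← List.reverse_reverse z, h]
    simp
  · refine Or.inr ⟨i, c, z'.reverse, hc, ?_⟩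
    rw [← List.reverse_reverse z, h]
    simp

theorem eq_append_singleton {x : List A} {a : A} (h : [a] <:+ x)
    (hx : 2 ≤ x.length) : ∃ y, y ≠ [] ∧ x = y ++ [a] := by
  obtain ⟨y, rfl⟩ := h
  refine ⟨y, ?_, rfl⟩
  rintro rfl
  simp at hx

theorem le_of_replicate_prefix {o c : A} (hc : c ≠ o) {i k : ℕ} {l : List A}
    (h : List.replicate i o <+: List.replicate k o ++ c :: l) : i ≤ k := by
  by_contra! hik
  have h1 : List.replicate k o ++ [c] <+: List.replicate k o ++ c :: l := ⟨l, by simp⟩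
  have h2 := List.prefix_of_prefix_length_le h1 h (by simp; omega)
  exact hc (List.eq_of_mem_replicate (h2.subset (by simp)))

/-- If a morphism `ψ` lifts and lowers long even palindromes of the language of `u`, then `u` has
exactly one infinite palindromic branch with empty center, and it is a fixed point of `ψ`. -/
theorem existsUnique_branch_of_desubstitution {u : RightWord A} {ψ : Morphism A} {o : A}
    (hne : ∀ a, ψ a ≠ []) (ho : ∃ y, y ≠ [] ∧ ψ o = y ++ [o]) (hoo : [o, o] ∈ language u)
    (hend : ∀ z, z ≠ [] → z ++ z.reverse ∈ language u → [o] <:+ z)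
    (hf : ∀ z, z ++ z.reverse ∈ language u →
      ψ.onWord z ++ (ψ.onWord z).reverse ∈ language u)
    (hb : ∀ N, ∃ N', ∀ z : List A, N' ≤ z.length → z ++ z.reverse ∈ language u →
      ∃ r x, N ≤ x.length ∧ x ++ x.reverse ∈ language u ∧ z = r ++ ψ.onWord x) :
    ∃ v, IsEmptyCenterBranch u v ∧ IsImageLeft ψ v v ∧
      ∀ v', IsEmptyCenterBranch u v' → v' = v := by
  have : Inhabited A := ⟨o⟩
  obtain ⟨y, hy, ho⟩ := ho
  have hsucc : ∀ k, ψ.iter (k + 1) [o] = ψ.iter k y ++ ψ.iter k [o] := by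
    intro k
    rw [← iter_append, ← ho]
    simp only [Morphism.iter, Function.iterate_succ_apply]
    rw [onWord_singleton]
  have hlen : ∀ k, k < (ψ.iter k [o]).length := by
    intro k
    induction k with
    | zero => simp [iter_zero]
    | succ k ih =>
      have := List.length_pos_iff.2 (iter_ne_nil hne k hy)
      rw [hsucc, List.length_append]
      omega
  have hmem : ∀ k, ψ.iter k [o] ++ (ψ.iter k [o]).reverse ∈ language u := by
    intro k
    induction k with
    | zero => exact hoo
    | succ k ih =>
      rw [iter_succ]
      exact hf _ ih
  -- Lowering a long even palindrome k times leaves a non-empty one, whose half ends with `o`;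
  -- applying ψ again k times puts ψ^k(o) at the end of the original half.
  have hsuf : ∀ k, ∃ N', ∀ z : List A, N' ≤ z.length → z ++ z.reverse ∈ language u →
      ψ.iter k [o] <:+ z := by
    intro k
    induction k with
    | zero =>
      refine ⟨1, fun z hz hzu => hend z ?_ hzu⟩
      rw [← List.length_pos_iff]
      omega
    | succ k ih =>
      obtain ⟨N, hN⟩ := ih
      obtain ⟨N', hN'⟩ := hb N
      refine ⟨N', fun z hz hzu => ?_⟩
      obtain ⟨r, x, hx, hxu, rfl⟩ := hN' z hz hzu
      rw [iter_succ]
      exact (onWord_suffix ψ (hN x hx hxu)).trans (List.suffix_append _ _)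
  -- Left infinite words are indexed from the right end, so the chain of suffixes ψ^k(o) is reversed
  -- into a chain of prefixes.
  obtain ⟨v, hv⟩ := exists_limit (fun k => (ψ.iter k [o]).reverse)
    (fun k => by rw [hsucc, List.reverse_append]; exact List.prefix_append _ _)
    (fun k => by rw [List.length_reverse]; exact hlen k)
  have hv' : ∀ k, ψ.iter k [o] = LeftWord.suf v (ψ.iter k [o]).length := by
    intro k
    have := hv k
    rw [List.length_reverse] at this
    rw [suf_eq_reverse_pre, ← this, List.reverse_reverse]
  have hvsuf : ∀ n, LeftWord.suf v n <:+ ψ.iter n [o] := by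
    intro n
    rw [hv' n]
    exact suf_suffix v (hlen n).le
  refine ⟨v, ?_, ⟨fun n => ?_, fun N => ⟨N, ?_⟩⟩, fun v' hbr => ?_⟩
  · intro n _
    rw [suf_append_reversal_pre]
    refine ⟨mem_language_of_infix ?_ (hmem n), by simp [IsPal]⟩
    obtain ⟨r, hr⟩ := hvsuf n
    rw [← hr]
    exact ⟨r, r.reverse, by simp⟩
  · have h1 := onWord_suffix ψ (hvsuf n)
    rw [← iter_succ, hv' (n + 1)] at h1
    exact eq_suf_of_suffix h1
  · have := length_le_onWord hne (LeftWord.suf v N)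
    rwa [suf_length] at this
  · have key : ∀ k, ψ.iter k [o] = v'.suf (ψ.iter k [o]).length := by
      intro k
      obtain ⟨N, hN⟩ := hsuf k
      -- Length `N + 1` rather than `N`, as a branch only constrains positive lengths.
      have h1 := (hbr (N + 1) (by omega)).1
      rw [suf_append_reversal_pre] at h1
      exact eq_suf_of_suffix (hN _ (by rw [suf_length]; omega) h1)
    funext n
    have h1 := (hv' n).symm.trans (key n)
    simp only [LeftWord.suf, List.reverse_inj, List.map_inj_left, List.mem_range] at h1
    exact (h1 n (hlen n)).symm

end general

/-! ### The substitution, its conjugates, and cutting of images -/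

section words

variable {m t s : ℕ} [NeZero m]

/-- The conjugate `a ↦ 0^(t-j) (a+1) 0^j`, `m - 1 ↦ 0^s` of `phi`. -/
def phiConj (m t s j : ℕ) [NeZero m] : Morphism (Fin m) := fun a =>
  if h : (a : ℕ) + 1 < m then
    List.replicate (t - j) 0 ++ [⟨a + 1, h⟩] ++ List.replicate j 0
  else List.replicate s 0

theorem phiConj_conj {j : ℕ} (hj : j ≤ t) (x : List (Fin m)) :
    (phi m t s).onWord x ++ List.replicate j 0 =
      List.replicate j 0 ++ (phiConj m t s j).onWord x := by
  refine onWord_conj (fun a => ?_) x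
  unfold phi phiConj
  split
  · rw [← List.append_assoc, ← List.append_assoc, List.replicate_append_replicate,
      Nat.add_sub_cancel' hj]
  · rw [List.replicate_append_replicate, List.replicate_append_replicate, add_comm]

theorem phi_reverse (x : List (Fin m)) :
    ((phi m t s).onWord x).reverse = (phiConj m t s t).onWord x.reverse := by
  refine onWord_reverse (fun a => ?_) x
  unfold phi phiConj
  split <;> simp

theorem phi_reverse_append (x : List (Fin m)) :
    (phi m t s).onWord x.reverse ++ List.replicate t 0 =
      List.replicate t 0 ++ ((phi m t s).onWord x).reverse := by
  rw [phiConj_conj le_rfl, phi_reverse]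

theorem phiConj_ne_nil (hs : 1 ≤ s) (j : ℕ) (a : Fin m) : phiConj m t s j a ≠ [] := by
  unfold phiConj
  split
  · simp
  · rw [ne_eq, List.replicate_eq_nil_iff]; omega

theorem phiConj_getLast (hs : 1 ≤ s) {j : ℕ} (hj : 1 ≤ j) {x : List (Fin m)} (hx : x ≠ []) :
    [0] <:+ (phiConj m t s j).onWord x := by
  obtain ⟨y, a, rfl⟩ := List.eq_nil_or_concat x |>.resolve_left hx
  rw [List.concat_eq_append, onWord_append, onWord_singleton]
  refine List.IsSuffix.trans ?_ (List.suffix_append _ _)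
  obtain ⟨j, rfl⟩ := Nat.exists_eq_add_of_le' hj
  obtain ⟨s, rfl⟩ := Nat.exists_eq_add_of_le' hs
  unfold phiConj
  split
  · rw [List.replicate_succ', ← List.append_assoc]
    exact List.suffix_append _ _
  · rw [List.replicate_succ']
    exact List.suffix_append _ _

/-- For j = t the images are (a+1)0^t and 0^s. Their first letters are pairwise distinct, so a word
can be decoded from left to right. -/
theorem phiConj_self_injective (hs : 1 ≤ s) {x y : List (Fin m)}
    (h : (phiConj m t s t).onWord x = (phiConj m t s t).onWord y) : x = y := by
  have hhead : ∀ a b : Fin m, (phiConj m t s t a).head? = (phiConj m t s t b).head? →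
      a = b := by
    intro a b hab
    obtain ⟨s, rfl⟩ := Nat.exists_eq_add_of_le' hs
    have ha := a.2
    have hb := b.2
    unfold phiConj at hab
    split at hab <;> split at hab <;>
      simp only [List.replicate_succ, List.head?_cons, List.cons_append, List.nil_append,
        Nat.sub_self, List.replicate_zero, Option.some.injEq, Fin.ext_iff, Fin.val_zero] at hab <;>
      apply Fin.ext <;> omega
  have hh : ∀ (a : Fin m) (x : List (Fin m)),
      ((phiConj m t s t).onWord (a :: x)).head? = (phiConj m t s t a).head? := by
    intro a x
    rw [onWord_cons, List.head?_append_of_ne_nil _ (phiConj_ne_nil hs t a)]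
  have hn : ∀ (a : Fin m) (x : List (Fin m)), (phiConj m t s t).onWord (a :: x) ≠ [] := by
    intro a x
    rw [onWord_cons]
    exact List.append_ne_nil_of_left_ne_nil (phiConj_ne_nil hs t a) _
  induction x generalizing y with
  | nil =>
    cases y with
    | nil => rfl
    | cons b y => exact absurd h.symm (hn b y)
  | cons a x ih =>
    cases y with
    | nil => exact absurd h (hn a x)
    | cons b y =>
      have h1 : a = b := hhead a b (by rw [← hh a x, ← hh b y, h])
      subst h1
      rw [onWord_cons, onWord_cons] at h
      rw [ih (List.append_cancel_left h)]

theorem phi_length_le (hst : s ≤ t) (x : List (Fin m)) :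
    ((phi m t s).onWord x).length ≤ (t + 1) * x.length := by
  induction x with
  | nil => simp [onWord_nil]
  | cons a x ih =>
    have h1 : (phi m t s a).length ≤ t + 1 := by
      unfold phi
      split
      · simp
      · simp; omega
    rw [onWord_cons, List.length_append, List.length_cons, mul_add]
    omega

/-- A non-zero letter occurs in an image of a letter only at its last position. This is what makes
non-zero letters into cutting points. -/
theorem phi_eq_append_cons {a c : Fin m} {p q : List (Fin m)} (hc : c ≠ 0)
    (h : phi m t s a = p ++ c :: q) :
    (a : ℕ) + 1 = c ∧ p = List.replicate t 0 ∧ q = [] := by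
  unfold phi at h
  split at h
  · rcases List.append_eq_append_iff.1 h with ⟨x, hp, hx⟩ | ⟨x, hp, hx⟩
    · have hx1 := congrArg List.length hx
      simp only [List.length_append, List.length_cons, List.length_nil] at hx1
      obtain rfl : x = [] := List.eq_nil_of_length_eq_zero (by omega)
      obtain ⟨h1, h2⟩ := List.cons_eq_cons.1 hx
      exact ⟨congrArg Fin.val h1, by simpa using hp, h2.symm⟩
    · cases x with
      | nil =>
        obtain ⟨h1, h2⟩ := List.cons_eq_cons.1 hx
        exact ⟨congrArg Fin.val h1.symm, by simpa using hp.symm, h2⟩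
      | cons b x =>
        obtain ⟨rfl, -⟩ := List.cons_eq_cons.1 hx
        exact absurd (List.eq_of_mem_replicate (n := t) (hp ▸ by simp)) hc
  · exact absurd (List.eq_of_mem_replicate (h ▸ by simp : c ∈ List.replicate s (0 : Fin m))) hc

/-- Cutting the image of a word after a non-zero letter. -/
theorem phi_cut {c : Fin m} (hc : c ≠ 0) {y p q : List (Fin m)}
    (h : (phi m t s).onWord y = p ++ c :: q) :
    ∃ (y₁ : List (Fin m)) (a : Fin m) (y₂ : List (Fin m)), y = y₁ ++ a :: y₂ ∧ (a : ℕ) + 1 = c ∧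
      p = (phi m t s).onWord y₁ ++ List.replicate t 0 ∧ q = (phi m t s).onWord y₂ := by
  induction y generalizing p with
  | nil => simp [onWord_nil] at h
  | cons b y ih =>
    rw [onWord_cons] at h
    rcases List.append_eq_append_iff.1 h with ⟨x, hp, hx⟩ | ⟨x, hp, hx⟩
    · obtain ⟨y₁, a, y₂, rfl, ha, rfl, hq⟩ := ih hx
      exact ⟨b :: y₁, a, y₂, rfl, ha, by rw [hp, onWord_cons, List.append_assoc], hq⟩
    · cases x with
      | nil =>
        obtain ⟨y₁, a, y₂, rfl, ha, h1, hq⟩ := ih (p := []) (by simpa using hx.symm)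
        refine ⟨b :: y₁, a, y₂, rfl, ha, ?_, hq⟩
        rw [onWord_cons, List.append_assoc, ← h1, hp]
        simp
      | cons d x =>
        obtain ⟨rfl, hq⟩ := List.cons_eq_cons.1 hx
        obtain ⟨h1, h2, rfl⟩ := phi_eq_append_cons hc hp
        exact ⟨[], b, y, rfl, h1, by simpa [onWord_nil] using h2, by simpa using hq⟩

theorem phi_of_lt {a : Fin m} (h : (a : ℕ) + 1 < m) :
    phi m t s a = List.replicate t 0 ++ [⟨a + 1, h⟩] := by
  rw [phi, dif_pos h]

theorem phi_of_not_lt {a : Fin m} (h : ¬(a : ℕ) + 1 < m) :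
    phi m t s a = List.replicate s 0 := by
  rw [phi, dif_neg h]

theorem phi_eq_zero_cons (ht : 1 ≤ t) (hs : 1 ≤ s) (a : Fin m) :
    ∃ x, phi m t s a = 0 :: x := by
  obtain ⟨t, rfl⟩ := Nat.exists_eq_add_of_le' ht
  obtain ⟨s, rfl⟩ := Nat.exists_eq_add_of_le' hs
  unfold phi
  split
  · exact ⟨_, by rw [List.replicate_succ, List.cons_append]⟩
  · exact ⟨_, by rw [List.replicate_succ]⟩

end words

/-! ### The language of the fixed point and its blocks of zeros -/

section lang

variable {m t s : ℕ} [NeZero m]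

theorem mem_language_uBeta_iff (hm : 2 ≤ m) (ht : 1 ≤ t) (hs : 1 ≤ s) (z : List (Fin m)) :
    z ∈ language (uBeta m t s) ↔ ∃ k, z <:+: (phi m t s).iter k [0] := by
  rw [mem_language_iff]
  constructor
  · rintro ⟨n, hn⟩
    refine ⟨n, hn.trans ?_⟩
    rw [iter_zero_eq_pre hm ht hs n]
    exact (pre_prefix _ (lt_length_iter_zero hm ht hs n).le).isInfix
  · rintro ⟨k, hk⟩
    rw [iter_zero_eq_pre hm ht hs k] at hk
    exact ⟨_, hk⟩

theorem onWord_mem_language (hm : 2 ≤ m) (ht : 1 ≤ t) (hs : 1 ≤ s) {z : List (Fin m)}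
    (h : z ∈ language (uBeta m t s)) : (phi m t s).onWord z ∈ language (uBeta m t s) := by
  rw [mem_language_uBeta_iff hm ht hs] at h ⊢
  obtain ⟨k, hk⟩ := h
  refine ⟨k + 1, ?_⟩
  rw [iter_succ]
  exact onWord_infix _ hk

theorem exists_infix_onWord (hm : 2 ≤ m) (ht : 1 ≤ t) (hs : 1 ≤ s) {z : List (Fin m)}
    (h : z ∈ language (uBeta m t s)) :
    ∃ y ∈ language (uBeta m t s), z <:+: (phi m t s).onWord y := by
  rw [mem_language_uBeta_iff hm ht hs] at h
  obtain ⟨k, hk⟩ := h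
  refine ⟨(phi m t s).iter k [0], ?_, hk.trans ?_⟩
  · rw [mem_language_uBeta_iff hm ht hs]
    exact ⟨k, List.infix_rfl⟩
  · rw [← iter_succ]
    exact (iter_zero_prefix_le hm ht hs k.le_succ).isInfix

/-- A non-zero letter closes the image of a letter, and the next image starts with 0. -/
theorem not_two_nonzero (hm : 2 ≤ m) (ht : 1 ≤ t) (hs : 1 ≤ s) {a b : Fin m}
    (h : [a, b] ∈ language (uBeta m t s)) (ha : a ≠ 0) : b = 0 := by
  obtain ⟨y, -, p, q, hy⟩ := exists_infix_onWord hm ht hs h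
  obtain ⟨-, -, y₂, -, -, -, hy₂⟩ := phi_cut ha (p := p) (q := b :: q) (by rw [← hy]; simp)
  cases y₂ with
  | nil => simp [onWord_nil] at hy₂
  | cons c y₂ =>
    obtain ⟨x, hx⟩ := phi_eq_zero_cons ht hs c
    rw [onWord_cons, hx, List.cons_append] at hy₂
    exact (List.cons_eq_cons.1 hy₂).1

theorem ne_zero_of_not_lt (hm : 2 ≤ m) {a : Fin m} (h : ¬(a : ℕ) + 1 < m) : a ≠ 0 := by
  rintro rfl
  rw [Fin.val_zero] at h
  omega

/-- Whatever follows z, its image starts with 0^t. One following letter a suffices unless a = m-1;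
then the next letter is 0 and φ(a0) = 0^(s+t)1. This is why z is extended by two letters. -/
theorem onWord_append_mem_language (hm : 2 ≤ m) (ht : 1 ≤ t) (hs : 1 ≤ s)
    {z : List (Fin m)} (h : z ∈ language (uBeta m t s)) :
    (phi m t s).onWord z ++ List.replicate t 0 ∈ language (uBeta m t s) := by
  obtain ⟨a, b, hab⟩ := exists_append_mem_language h
  refine mem_language_of_infix ?_ (onWord_mem_language hm ht hs hab)
  rw [onWord_append]
  refine ((List.prefix_append_right_inj _).2 ?_).isInfix
  rw [onWord_cons, onWord_singleton]
  by_cases ha : (a : ℕ) + 1 < m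
  · rw [phi_of_lt ha, List.append_assoc]
    exact List.prefix_append _ _
  · have hb : b = 0 := not_two_nonzero hm ht hs
      (mem_language_of_infix (List.suffix_append _ _).isInfix hab) (ne_zero_of_not_lt hm ha)
    have h0 : ((0 : Fin m) : ℕ) + 1 < m := by rw [Fin.val_zero]; omega
    rw [hb, phi_of_not_lt ha, phi_of_lt h0, ← List.append_assoc,
      List.replicate_append_replicate, add_comm, ← List.replicate_append_replicate,
      List.append_assoc]
    exact List.prefix_append _ _

theorem singleton_mem_language (hm : 2 ≤ m) (ht : 1 ≤ t) (hs : 1 ≤ s) (a : Fin m) :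
    [a] ∈ language (uBeta m t s) := by
  obtain ⟨a, ha⟩ := a
  induction a with
  | zero =>
    rw [mem_language_uBeta_iff hm ht hs]
    exact ⟨0, List.infix_rfl⟩
  | succ a ih =>
    have h := onWord_mem_language hm ht hs (ih (by omega))
    rw [onWord_singleton, phi_of_lt (by exact ha)] at h
    exact mem_language_of_infix (List.suffix_append _ _).isInfix h

theorem replicate_mem_language (hm : 2 ≤ m) (ht : 1 ≤ t) (hs : 1 ≤ s) :
    List.replicate (s + t) 0 ∈ language (uBeta m t s) := by
  have h := onWord_append_mem_language hm ht hs
    (singleton_mem_language hm ht hs ⟨m - 1, by omega⟩)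
  rwa [onWord_singleton, phi_of_not_lt (by simp; omega), List.replicate_append_replicate] at h

theorem le_of_replicate_prefix_onWord (hm : 2 ≤ m) (ht : 1 ≤ t) (hs : 1 ≤ s)
    {y : List (Fin m)} (hy : y ∈ language (uBeta m t s)) {i : ℕ}
    (h : List.replicate i 0 <+: (phi m t s).onWord y) : i ≤ s + t := by
  have hne : ∀ (a : ℕ) (ha : a + 1 < m), (⟨a + 1, ha⟩ : Fin m) ≠ 0 := by
    intro a ha h0
    have := congrArg Fin.val h0
    simp at this
  cases y with
  | nil =>
    have := h.length_le
    simp [onWord_nil] at this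
    omega
  | cons c y =>
    rw [onWord_cons] at h
    by_cases hc : (c : ℕ) + 1 < m
    · rw [phi_of_lt hc, List.append_assoc] at h
      have := le_of_replicate_prefix (hne _ hc) h
      omega
    · rw [phi_of_not_lt hc] at h
      cases y with
      | nil =>
        have := h.length_le
        simp [onWord_nil] at this
        omega
      | cons d y =>
        have hd : d = 0 := not_two_nonzero hm ht hs
          (mem_language_of_infix ⟨[], y, rfl⟩ hy) (ne_zero_of_not_lt hm hc)
        have h0 : ((0 : Fin m) : ℕ) + 1 < m := by rw [Fin.val_zero]; omega
        rw [hd, onWord_cons, phi_of_lt h0, List.append_assoc, ← List.append_assoc,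
          List.replicate_append_replicate] at h
        exact le_of_replicate_prefix (hne _ h0) h

theorem le_of_replicate_mem_language (hm : 2 ≤ m) (ht : 1 ≤ t) (hs : 1 ≤ s) {i : ℕ}
    (h : List.replicate i 0 ∈ language (uBeta m t s)) : i ≤ s + t := by
  obtain ⟨y, hyu, p, q, hy⟩ := exists_infix_onWord hm ht hs h
  -- Cutting after the last non-zero letter before the block, if there is one, makes the block part
  -- of a prefix of zeros of an image.
  rcases eq_replicate_or_exists_right 0 p with hp | ⟨k, c, p', hc, hp⟩
  · have := le_of_replicate_prefix_onWord hm ht hs hyu (i := p.length + i)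
      ⟨q, by rw [← hy, ← List.replicate_append_replicate, ← hp]⟩
    omega
  · obtain ⟨y₁, a, y₂, rfl, -, -, hy₂⟩ := phi_cut hc (p := p')
      (q := List.replicate k 0 ++ List.replicate i 0 ++ q) (by rw [← hy, hp]; simp)
    have := le_of_replicate_prefix_onWord hm ht hs (y := y₂) (i := k + i)
      (mem_language_of_infix ⟨y₁ ++ [a], [], by simp⟩ hyu)
      ⟨q, by rw [← hy₂, List.replicate_append_replicate]⟩
    omega

/-! ### Lifting and lowering palindromes -/

/-- The image of a palindrome with center `d`, extended by `0^t`, has center `e`, and `0^j` is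
what separates it from the image of the left half. -/
def CenterStep (m t s : ℕ) [NeZero m] (d : List (Fin m)) (j : ℕ) (e : List (Fin m)) : Prop :=
  (phi m t s).onWord d ++ List.replicate t 0 = List.replicate j 0 ++ e ++ List.replicate j 0

/-- The word φ(x d x~)0^t belongs to the language and equals 0^j · φ_j(x) e φ_j(x)~ · 0^j:
conjugation by 0^j on the left half, its mirror image on the right half. -/
theorem CenterStep.lift (hm : 2 ≤ m) (ht : 1 ≤ t) (hs : 1 ≤ s) {d e : List (Fin m)} {j : ℕ}
    (hj : j ≤ t) (h : CenterStep m t s d j e) {x : List (Fin m)}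
    (hx : x ++ d ++ x.reverse ∈ language (uBeta m t s)) :
    (phiConj m t s j).onWord x ++ e ++ ((phiConj m t s j).onWord x).reverse ∈
      language (uBeta m t s) := by
  refine mem_language_of_infix ?_ (onWord_append_mem_language hm ht hs hx)
  refine ⟨List.replicate j 0, List.replicate j 0, ?_⟩
  have h1 := phiConj_conj (s := s) hj x
  have h2 := congrArg List.reverse h1
  rw [List.reverse_append, List.reverse_append, List.reverse_replicate] at h2
  unfold CenterStep at h
  calc _ = (List.replicate j 0 ++ (phiConj m t s j).onWord x) ++ e ++
        (((phiConj m t s j).onWord x).reverse ++ List.replicate j 0) := by simp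
    _ = (phi m t s).onWord x ++ (List.replicate j 0 ++ e ++ List.replicate j 0) ++
        ((phi m t s).onWord x).reverse := by rw [← h1, ← h2]; simp
    _ = _ := by
      rw [← h, onWord_append, onWord_append, List.append_assoc _ _ (List.replicate t 0),
        phi_reverse_append]
      simp

/-- Since |φ(d)0^t| ≤ 2t+1, the word g has length at most t, and φ(d)0^t starts with 0^t even for d
= m-1. Thus g is a block of zeros. -/
theorem exists_centerStep (hst : s ≤ t) {d e g : List (Fin m)} (hd : d.length ≤ 1)
    (h : (phi m t s).onWord d ++ List.replicate t 0 = g ++ e ++ g.reverse) :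
    g = List.replicate g.length 0 ∧ g.length ≤ t ∧ CenterStep m t s d g.length e := by
  have hl := congrArg List.length h
  have hlen : g.length ≤ t := by
    have := phi_length_le hst d
    have h2 : (t + 1) * d.length ≤ (t + 1) * 1 := Nat.mul_le_mul_left _ hd
    simp only [List.length_append, List.length_reverse, List.length_replicate] at hl
    omega
  have hpre : ∃ r, List.replicate t 0 ++ r = g ++ (e ++ g.reverse) := by
    rw [← List.append_assoc, ← h]
    match d, hd with
    | [], _ => exact ⟨[], by simp [onWord_nil]⟩
    | [a], _ =>
      rw [onWord_singleton]
      by_cases ha : (a : ℕ) + 1 < m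
      · rw [phi_of_lt ha, List.append_assoc]
        exact ⟨_, rfl⟩
      · rw [phi_of_not_lt ha, List.replicate_append_replicate, add_comm,
          ← List.replicate_append_replicate]
        exact ⟨_, rfl⟩
  obtain ⟨r, hr⟩ := hpre
  have hgp : g <+: List.replicate t 0 :=
    List.prefix_of_prefix_length_le ⟨_, rfl⟩ ⟨r, hr⟩ (by simpa using hlen)
  have hg : g = List.replicate g.length 0 :=
    List.eq_replicate_iff.2 ⟨rfl, fun b hb => List.eq_of_mem_replicate (hgp.subset hb)⟩
  refine ⟨hg, hlen, ?_⟩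
  have hg2 : g.reverse = List.replicate g.length 0 := by
    conv_lhs => rw [hg, List.reverse_replicate]
  unfold CenterStep
  rw [h, hg2, ← hg]

/-- Long palindromes of the language come from shorter palindromes. -/
theorem exists_desubstitution (hm : 2 ≤ m) (ht : 1 ≤ t) (hs : 1 ≤ s) (hst : s ≤ t) (N : ℕ) :
    ∃ N', ∀ z e : List (Fin m), e.length ≤ 1 → N' ≤ z.length →
      z ++ e ++ z.reverse ∈ language (uBeta m t s) →
      ∃ d j x r, d.length ≤ 1 ∧ j ≤ t ∧ CenterStep m t s d j e ∧ N ≤ x.length ∧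
        x ++ d ++ x.reverse ∈ language (uBeta m t s) ∧
        z = r ++ (phiConj m t s j).onWord x := by
  -- Below, z = 0^i c φ(x) g with i ≤ s+t, |φ(x)| ≤ (t+1)|x| and |g| ≤ t, so a half z of this length
  -- forces |x| ≥ N. It also exceeds the longest block of zeros.
  refine ⟨s + t + 2 + (t + 1) * N + t, fun z e he hz hzu => ?_⟩
  rcases eq_replicate_or_exists_left 0 z with h | ⟨i, c, z', hc, rfl⟩
  · rw [h, List.append_assoc] at hzu
    have := le_of_replicate_mem_language hm ht hs
      (mem_language_of_infix (List.prefix_append _ _).isInfix hzu)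
    omega
  have hi : i ≤ s + t := by
    refine le_of_replicate_mem_language hm ht hs (mem_language_of_infix ?_ hzu)
    rw [List.append_assoc, List.append_assoc]
    exact (List.prefix_append _ _).isInfix
  obtain ⟨y, hyu, p, q, hy⟩ := exists_infix_onWord hm ht hs hzu
  -- Cuts after the first non-zero letter c of z and then at its mirror image: the part in between
  -- is exactly φ(Q)0^t, with 0^t coming from the image of the letter that ends in the second c.
  obtain ⟨y₁, a, y₂, rfl, -, -, hy₂⟩ := phi_cut hc (p := p ++ List.replicate i 0)
    (q := (z' ++ e ++ z'.reverse) ++ c :: (List.replicate i 0 ++ q)) (by rw [← hy]; simp)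
  obtain ⟨Q, b, y₃, rfl, -, hQ, -⟩ := phi_cut hc hy₂.symm
  have hQu : Q ∈ language (uBeta m t s) :=
    mem_language_of_infix ⟨y₁ ++ [a], b :: y₃, by simp⟩ hyu
  -- Both φ(Q~)0^t and φ(Q)0^t equal the same palindrome; moving 0^t to the front leaves φ_t(Q~) =
  -- φ_t(Q).
  have hQr : Q.reverse = Q := by
    have h1 : (z' ++ e ++ z'.reverse).reverse = z' ++ e ++ z'.reverse := by
      match e, he with
      | [], _ => simp
      | [a], _ => simp
    rw [hQ, List.reverse_append, List.reverse_replicate, ← phi_reverse_append,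
      phiConj_conj le_rfl, phiConj_conj le_rfl] at h1
    exact phiConj_self_injective hs (List.append_cancel_left h1)
  obtain ⟨x, d, hd, rfl⟩ := palindrome_decomp hQr
  have h2 : z' ++ e ++ z'.reverse = (phi m t s).onWord x ++
      ((phi m t s).onWord d ++ List.replicate t 0) ++ ((phi m t s).onWord x).reverse := by
    rw [hQ, onWord_append, onWord_append, List.append_assoc _ _ (List.replicate t 0),
        phi_reverse_append]
    simp
  obtain ⟨g, rfl, hg⟩ := center_of_eq h2 (by simp; omega)
  obtain ⟨hg0, hgt, hstep⟩ := exists_centerStep hst hd hg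
  refine ⟨d, g.length, x, List.replicate i 0 ++ c :: List.replicate g.length 0, hd, hgt, hstep,
    ?_, hQu, ?_⟩
  · by_contra! hx
    have h3 := phi_length_le hst x
    have h4 : (t + 1) * x.length ≤ (t + 1) * N := Nat.mul_le_mul_left _ hx.le
    simp only [List.length_append, List.length_cons, List.length_replicate] at hz
    omega
  · rw [List.append_assoc, List.cons_append, ← phiConj_conj hgt, ← hg0]

/-! ### Which centers lead to which -/

theorem CenterStep.of_nil {d : List (Fin m)} {j : ℕ} (hd : d.length ≤ 1)
    (h : CenterStep m t s d j []) :
    (d = [] ∧ t = 2 * j) ∨ (∃ a, d = [a] ∧ (a : ℕ) + 1 = m ∧ s + t = 2 * j) := by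
  have hl := congrArg List.length h
  match d, hd with
  | [], _ =>
    simp [onWord_nil] at hl
    exact Or.inl ⟨rfl, by omega⟩
  | [a], _ =>
    have ham := a.2
    rw [onWord_singleton] at hl
    by_cases ha : (a : ℕ) + 1 < m
    · simp [phi_of_lt ha] at hl
      omega
    · simp [phi_of_not_lt ha] at hl
      exact Or.inr ⟨a, rfl, by omega, by omega⟩

/-- Comparing lengths, 2j+1 is t for d = ε, 2t+1 for d = a < m-1, and s+t for d = m-1. The last
alternative omits d, as it is only ever excluded by parity or by b ≠ 0. -/
theorem CenterStep.of_singleton {d : List (Fin m)} {j : ℕ} {b : Fin m} (hd : d.length ≤ 1)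
    (h : CenterStep m t s d j [b]) :
    (d = [] ∧ b = 0 ∧ t = 2 * j + 1) ∨ (∃ a, d = [a] ∧ (a : ℕ) + 1 = b ∧ j = t) ∨
      (b = 0 ∧ s + t = 2 * j + 1) := by
  have hl := congrArg List.length h
  unfold CenterStep at h
  match d, hd with
  | [], _ =>
    simp [onWord_nil] at hl
    rw [onWord_nil, List.nil_append] at h
    exact Or.inl ⟨rfl, List.eq_of_mem_replicate (n := t) (h ▸ by simp), by omega⟩
  | [a], _ =>
    have ham := a.2
    rw [onWord_singleton] at hl h
    by_cases ha : (a : ℕ) + 1 < m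
    · simp [phi_of_lt ha] at hl
      obtain rfl : t = j := by omega
      rw [phi_of_lt ha, List.append_assoc, List.append_assoc] at h
      obtain ⟨hb, -⟩ := List.cons_eq_cons.1 (List.append_cancel_left h)
      exact Or.inr (Or.inl ⟨a, rfl, congrArg Fin.val hb, rfl⟩)
    · simp [phi_of_not_lt ha] at hl
      rw [phi_of_not_lt ha, List.replicate_append_replicate] at h
      exact Or.inr (Or.inr
        ⟨List.eq_of_mem_replicate (n := s + t) (h ▸ by simp), by omega⟩)

theorem centerStep_nil_nil {j : ℕ} (h : t = 2 * j) : CenterStep m t s [] j [] := by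
  simp [CenterStep, onWord_nil, List.replicate_append_replicate, h, two_mul]

theorem centerStep_nil_zero {j : ℕ} (h : t = 2 * j + 1) : CenterStep m t s [] j [0] := by
  simp only [CenterStep, onWord_nil, List.nil_append]
  rw [← List.replicate_succ', List.replicate_append_replicate]
  congr 1
  omega

theorem centerStep_singleton {a : Fin m} (h : (a : ℕ) + 1 < m) :
    CenterStep m t s [a] t [⟨a + 1, h⟩] := by
  rw [CenterStep, onWord_singleton, phi_of_lt h]

theorem centerStep_last {a : Fin m} (ha : (a : ℕ) + 1 = m) {j : ℕ} (h : s + t = 2 * j) :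
    CenterStep m t s [a] j [] := by
  rw [CenterStep, onWord_singleton, phi_of_not_lt (by omega), List.append_nil,
    List.replicate_append_replicate, List.replicate_append_replicate, h, two_mul]

/-- If `t` and `s` are even, long palindromes do not have odd length. -/
theorem exists_not_mem_language (hm : 2 ≤ m) (ht : 1 ≤ t) (hs : 1 ≤ s) (hst : s ≤ t)
    (het : Even t) (hes : Even s) (b : Fin m) :
    ∃ N, ∀ z : List (Fin m), N ≤ z.length →
      z ++ [b] ++ z.reverse ∉ language (uBeta m t s) := by
  rw [Nat.even_iff] at het hes
  obtain ⟨b, hb⟩ := b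
  -- Center 0 would require t or s+t to be odd, so it has no predecessor; center b+1 can only come
  -- from center b.
  induction b with
  | zero =>
    obtain ⟨N, hN⟩ := exists_desubstitution hm ht hs hst 0
    refine ⟨N, fun z hz hzu => ?_⟩
    obtain ⟨d, j, x, r, hd, -, hstep, -, -, -⟩ := hN z _ (by simp) hz hzu
    rcases hstep.of_singleton hd with ⟨-, -, h⟩ | ⟨a, -, h, -⟩ | ⟨-, h⟩
    · omega
    · simp at h
    · omega
  | succ b ih =>
    obtain ⟨N, hN⟩ := ih (by omega)
    obtain ⟨N', hN'⟩ := exists_desubstitution hm ht hs hst N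
    refine ⟨N', fun z hz hzu => ?_⟩
    obtain ⟨d, j, x, r, hd, -, hstep, hx, hxu, -⟩ := hN' z _ (by simp) hz hzu
    rcases hstep.of_singleton hd with ⟨-, -, h⟩ | ⟨a, rfl, h, -⟩ | ⟨-, h⟩
    · omega
    · rw [show a = ⟨b, by omega⟩ from Fin.ext (by simpa using h)] at hxu
      exact hN x hx hxu
    · omega

theorem lift_iterate (hm : 2 ≤ m) (ht : 1 ≤ t) (hs : 1 ≤ s) {x : List (Fin m)}
    (hx : x ++ [0] ++ x.reverse ∈ language (uBeta m t s)) {b : ℕ} (hb : b < m) :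
    (phiConj m t s t).iter b x ++ [⟨b, hb⟩] ++ ((phiConj m t s t).iter b x).reverse ∈
      language (uBeta m t s) := by
  induction b with
  | zero => exact hx
  | succ b ih =>
    rw [iter_succ]
    exact (centerStep_singleton (a := ⟨b, by omega⟩) hb).lift hm ht hs le_rfl (ih (by omega))

theorem exists_desubstitution_iterate (hm : 2 ≤ m) (ht : 1 ≤ t) (hs : 1 ≤ s) (hst : s ≤ t)
    {b : ℕ} (hb : b < m) (N : ℕ) :
    ∃ N', ∀ z : List (Fin m), N' ≤ z.length →
      z ++ [⟨b, hb⟩] ++ z.reverse ∈ language (uBeta m t s) →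
      ∃ x r, N ≤ x.length ∧ x ++ [0] ++ x.reverse ∈ language (uBeta m t s) ∧
        z = r ++ (phiConj m t s t).iter b x := by
  induction b with
  | zero => exact ⟨N, fun z hz hzu => ⟨z, [], hz, hzu, rfl⟩⟩
  | succ b ih =>
    obtain ⟨M, hM⟩ := ih (by omega)
    obtain ⟨N', hN'⟩ := exists_desubstitution hm ht hs hst M
    refine ⟨N', fun z hz hzu => ?_⟩
    obtain ⟨d, j, x, r, hd, -, hstep, hx, hxu, rfl⟩ := hN' z _ (by simp) hz hzu
    rcases hstep.of_singleton hd with ⟨-, h, -⟩ | ⟨a, rfl, h, rfl⟩ | ⟨h, -⟩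
    · simp [Fin.ext_iff] at h
    · rw [show a = ⟨b, by omega⟩ from Fin.ext (by simpa using h)] at hxu
      obtain ⟨y, r', hy, hyu, rfl⟩ := hM x hx hxu
      exact ⟨y, r ++ (phiConj m j s j).onWord r', hy, hyu,
        by rw [iter_succ, onWord_append, List.append_assoc]⟩
    · simp [Fin.ext_iff] at h

/-! ### The branch for even t -/

theorem suffix_of_even_palindrome (hm : 2 ≤ m) (ht : 1 ≤ t) (hs : 1 ≤ s) {z : List (Fin m)}
    (hz : z ≠ []) (h : z ++ z.reverse ∈ language (uBeta m t s)) : [0] <:+ z := by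
  obtain ⟨y, a, rfl⟩ := List.eq_nil_or_concat z |>.resolve_left hz
  rw [List.concat_eq_append] at h ⊢
  have h1 : [a, a] ∈ language (uBeta m t s) :=
    mem_language_of_infix ⟨y, y.reverse, by simp⟩ h
  by_cases ha : a = 0
  · rw [ha]
    exact List.suffix_append _ _
  · exact absurd (not_two_nonzero hm ht hs h1 ha) ha

theorem zero_zero_mem_language (hm : 2 ≤ m) (ht : 1 ≤ t) (hs : 1 ≤ s) :
    [0, 0] ∈ language (uBeta m t s) := by
  refine mem_language_of_infix ?_ (replicate_mem_language hm ht hs)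
  obtain ⟨k, hk⟩ := Nat.exists_eq_add_of_le (show 2 ≤ s + t by omega)
  rw [hk, ← List.replicate_append_replicate]
  exact (List.prefix_append _ _).isInfix

theorem phiConj_zero_length (hm : 2 ≤ m) (ht : 1 ≤ t) {j : ℕ} (hj : j ≤ t) :
    2 ≤ (phiConj m t s j 0).length := by
  have h0 : ((0 : Fin m) : ℕ) + 1 < m := by rw [Fin.val_zero]; omega
  rw [phiConj, dif_pos h0]
  simp
  omega

theorem phiConj_zero_eq_cons (hm : 2 ≤ m) {j : ℕ} (hj : j < t) :
    ∃ x, phiConj m t s j 0 = 0 :: x := by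
  have h0 : ((0 : Fin m) : ℕ) + 1 < m := by rw [Fin.val_zero]; omega
  obtain ⟨k, hk⟩ := Nat.exists_eq_add_of_le' (show 1 ≤ t - j by omega)
  rw [phiConj, dif_pos h0, hk]
  exact ⟨_, by rw [List.replicate_succ, List.cons_append, List.cons_append]⟩

theorem isSubstitution_of_zero {ψ : Morphism (Fin m)} (hne : ∀ a, ψ a ≠ [])
    (h : ∃ x, ψ 0 = 0 :: x) (hl : 2 ≤ (ψ 0).length) : IsSubstitution ψ := by
  obtain ⟨x, hx⟩ := h
  refine ⟨hne, 0, x, ?_, hx⟩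
  rintro rfl
  simp [hx] at hl

theorem existsUnique_branch_of_even (hm : 2 ≤ m) (hs : 1 ≤ s) (hst : s ≤ t) (het : Even t) :
    ∃ v, IsEmptyCenterBranch (uBeta m t s) v ∧ IsImageLeft (phiConj m t s (t / 2)) v v ∧
      ∀ v', IsEmptyCenterBranch (uBeta m t s) v' → v' = v := by
  have ht : 1 ≤ t := hs.trans hst
  have het' := Nat.even_iff.1 het
  refine existsUnique_branch_of_desubstitution (o := 0) (phiConj_ne_nil hs _) ?_
    (zero_zero_mem_language hm ht hs) (fun z => suffix_of_even_palindrome hm ht hs) ?_ ?_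
  · refine eq_append_singleton ?_ (phiConj_zero_length hm ht (by omega))
    rw [← onWord_singleton (phiConj m t s _)]
    exact phiConj_getLast hs (by omega) (by simp)
  · intro z hz
    have := (centerStep_nil_nil (m := m) (s := s) (j := t / 2) (by omega)).lift hm ht hs
      (by omega) (x := z) (by simpa using hz)
    simpa using this
  · intro N
    -- Excludes the step m-1 → ε: for s odd it is impossible by parity, and for s even its source
    -- has bounded length.
    obtain ⟨M, hM⟩ : ∃ M, ∀ a : Fin m, (a : ℕ) + 1 = m → s % 2 = 0 →
        ∀ z : List (Fin m), M ≤ z.length →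
          z ++ [a] ++ z.reverse ∉ language (uBeta m t s) := by
      by_cases hes : Even s
      · obtain ⟨M, hM⟩ := exists_not_mem_language hm ht hs hst het hes ⟨m - 1, by omega⟩
        refine ⟨M, fun a ha _ => ?_⟩
        rw [show a = ⟨m - 1, by omega⟩ from Fin.ext (by simp; omega)]
        exact hM
      · exact ⟨0, fun a _ h => absurd (Nat.even_iff.2 h) hes⟩
    obtain ⟨N', hN'⟩ := exists_desubstitution hm ht hs hst (max M N)
    refine ⟨N', fun z hz hzu => ?_⟩
    obtain ⟨d, j, x, r, hd, -, hstep, hx, hxu, rfl⟩ := hN' z [] (by simp) hz (by simpa using hzu)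
    rcases hstep.of_nil hd with ⟨rfl, h⟩ | ⟨a, rfl, ha, h⟩
    · obtain rfl : j = t / 2 := by omega
      exact ⟨r, x, by omega, by simpa using hxu, rfl⟩
    · exact absurd hxu (hM a ha (by omega) x (by omega))

/-! ### The branch for odd t and s -/

/-- The conjugate of `phi^(m+1)` that fixes the branch when `t` and `s` are odd. -/
def oddConj (m t s : ℕ) [NeZero m] (x : List (Fin m)) : List (Fin m) :=
  (phiConj m t s ((s + t) / 2)).onWord
    ((phiConj m t s t).iter (m - 1) ((phiConj m t s ((t - 1) / 2)).onWord x))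

theorem oddConj_append (x y : List (Fin m)) :
    oddConj m t s (x ++ y) = oddConj m t s x ++ oddConj m t s y := by
  simp only [oddConj, onWord_append, iter_append]

theorem onWord_eq_oddConj {ψ : Morphism (Fin m)} (h : ∀ a, ψ a = oddConj m t s [a])
    (x : List (Fin m)) : ψ.onWord x = oddConj m t s x := by
  induction x with
  | nil =>
    -- The image of the empty word is idempotent under concatenation, hence empty.
    refine (List.append_cancel_left (as := oddConj m t s []) ?_).symm
    rw [← oddConj_append, onWord_nil, List.append_nil, List.append_nil]
  | cons a x ih => rw [onWord_cons, ih, h, ← oddConj_append, List.singleton_append]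

theorem oddConj_ne_nil (hs : 1 ≤ s) (a : Fin m) : oddConj m t s [a] ≠ [] := by
  have h1 := length_le_onWord (phiConj_ne_nil (m := m) (t := t) hs ((t - 1) / 2)) [a]
  have h2 := length_le_iter (phiConj_ne_nil (m := m) (t := t) hs t) (m - 1)
    ((phiConj m t s ((t - 1) / 2)).onWord [a])
  have h3 := length_le_onWord (phiConj_ne_nil (m := m) (t := t) hs ((s + t) / 2))
    ((phiConj m t s t).iter (m - 1) ((phiConj m t s ((t - 1) / 2)).onWord [a]))
  rw [← List.length_pos_iff, oddConj]
  simp only [List.length_singleton] at h1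
  omega

theorem oddConj_zero_length (hm : 2 ≤ m) (ht : 1 ≤ t) (hs : 1 ≤ s) :
    2 ≤ (oddConj m t s [0]).length := by
  have h1 := phiConj_zero_length (s := s) hm ht (j := (t - 1) / 2) (by omega)
  have h2 := length_le_iter (phiConj_ne_nil (m := m) (t := t) hs t) (m - 1)
    ((phiConj m t s ((t - 1) / 2)).onWord [0])
  have h3 := length_le_onWord (phiConj_ne_nil (m := m) (t := t) hs ((s + t) / 2))
    ((phiConj m t s t).iter (m - 1) ((phiConj m t s ((t - 1) / 2)).onWord [0]))
  rw [← onWord_singleton (phiConj m t s _)] at h1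
  rw [oddConj]
  omega

theorem oddConj_zero_suffix (hs : 1 ≤ s) (ht : 1 ≤ t) : [0] <:+ oddConj m t s [0] := by
  refine phiConj_getLast hs (by omega) (iter_ne_nil (phiConj_ne_nil hs t) _ ?_)
  rw [onWord_singleton]
  exact phiConj_ne_nil hs _ _

theorem phiConj_iter_zero_cons (x : List (Fin m)) {k : ℕ} (hk : k < m) :
    ∃ y, (phiConj m t s t).iter k (0 :: x) = ⟨k, hk⟩ :: y := by
  induction k with
  | zero => exact ⟨x, rfl⟩
  | succ k ih =>
    obtain ⟨y, hy⟩ := ih (by omega)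
    rw [iter_succ, hy, onWord_cons, phiConj, dif_pos hk]
    exact ⟨_, by simp; rfl⟩

/-- The first letter goes 0 ↦ 0 under the first factor, is raised to m-1 by the m-1 applications of
φ_t, and returns to 0 since m-1 ↦ 0^s. -/
theorem oddConj_zero_eq_cons (hm : 2 ≤ m) (ht : 1 ≤ t) (hs : 1 ≤ s) :
    ∃ x, oddConj m t s [0] = 0 :: x := by
  obtain ⟨x, hx⟩ := phiConj_zero_eq_cons (s := s) hm (j := (t - 1) / 2) (t := t) (by omega)
  obtain ⟨y, hy⟩ := phiConj_iter_zero_cons (t := t) (s := s) x (k := m - 1) (by omega)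
  obtain ⟨s, rfl⟩ := Nat.exists_eq_add_of_le' hs
  rw [oddConj, onWord_singleton, hx, hy, onWord_cons, phiConj, dif_neg (by simp; omega),
    List.replicate_succ, List.cons_append]
  exact ⟨_, rfl⟩

/-- Conjugating words compose: if φ^k(x)q = qX, then φ^(k+1)(x) · φ(q)0^j = φ(q)0^j · φ_j(X).
Following this along the cycle builds up w. -/
theorem phi_iter_conj (hm : 2 ≤ m) (hst : s ≤ t) (hot : Odd t) (hos : Odd s)
    (x : List (Fin m)) :
    let w := (phi m t s).iter m (List.replicate ((t + 1) / 2) 0) ++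
      List.replicate ((t - s) / 2) 0
    (phi m t s).iter (m + 1) x ++ w = w ++ oddConj m t s x := by
  intro w
  rw [Nat.odd_iff] at hot hos
  -- The conjugating word q is φ^k(0^((t+1)/2)) without its last letter k. This persists because
  -- φ(qk) = φ(q)0^t(k+1) and the next step has j = t.
  have key : ∀ k, ∀ hk : k < m, ∃ q : List (Fin m),
      (phi m t s).iter k (List.replicate ((t - 1) / 2) 0 ++ [0]) = q ++ [⟨k, hk⟩] ∧
      (phi m t s).iter (k + 1) x ++ q =
        q ++ (phiConj m t s t).iter k ((phiConj m t s ((t - 1) / 2)).onWord x) := by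
    intro k
    induction k with
    | zero => exact fun hk => ⟨List.replicate ((t - 1) / 2) 0, rfl, phiConj_conj (by omega) x⟩
    | succ k ih =>
      intro hk
      obtain ⟨q, hq1, hq2⟩ := ih (by omega)
      refine ⟨(phi m t s).onWord q ++ List.replicate t 0, ?_, ?_⟩
      · rw [iter_succ, hq1, onWord_append, onWord_singleton, phi_of_lt (by exact hk),
          List.append_assoc]
      · rw [iter_succ _ (k + 1), iter_succ (phiConj m t s t) k, ← List.append_assoc,
          ← onWord_append, hq2, onWord_append, List.append_assoc, phiConj_conj le_rfl, List.append_assoc]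
  obtain ⟨q, hq1, hq2⟩ := key (m - 1) (by omega)
  have hm1 : m - 1 + 1 = m := by omega
  -- In the last step φ(m-1) = 0^s, and s + (t-s)/2 = (s+t)/2 is the exponent for m-1 → ε.
  have hw : w = (phi m t s).onWord q ++ List.replicate ((s + t) / 2) 0 := by
    have h1 : List.replicate ((t + 1) / 2) (0 : Fin m) =
        List.replicate ((t - 1) / 2) 0 ++ [0] := by
      rw [← List.replicate_succ']
      congr 1
      omega
    have h2 := iter_succ (phi m t s) (m - 1) (List.replicate ((t - 1) / 2) 0 ++ [0])
    rw [hq1, hm1, onWord_append, onWord_singleton, phi_of_not_lt (by simp; omega)] at h2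
    simp only [w]
    rw [h1, h2, List.append_assoc, List.replicate_append_replicate]
    congr 2
    omega
  rw [hm1] at hq2
  rw [hw, iter_succ, ← List.append_assoc, ← onWord_append, hq2, onWord_append,
    List.append_assoc, phiConj_conj (by omega), List.append_assoc, oddConj]

theorem existsUnique_branch_of_odd (hm : 2 ≤ m) (hs : 1 ≤ s) (hst : s ≤ t) (hot : Odd t)
    (hos : Odd s) {ψ : Morphism (Fin m)} (hψ : ∀ a, ψ a = oddConj m t s [a]) :
    ∃ v, IsEmptyCenterBranch (uBeta m t s) v ∧ IsImageLeft ψ v v ∧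
      ∀ v', IsEmptyCenterBranch (uBeta m t s) v' → v' = v := by
  have ht : 1 ≤ t := hs.trans hst
  rw [Nat.odd_iff] at hot hos
  refine existsUnique_branch_of_desubstitution (o := 0)
    (fun a => by rw [hψ]; exact oddConj_ne_nil hs a) ?_
    (zero_zero_mem_language hm ht hs) (fun z => suffix_of_even_palindrome hm ht hs) ?_ ?_
  · rw [hψ]
    exact eq_append_singleton (oddConj_zero_suffix hs ht) (oddConj_zero_length hm ht hs)
  · intro z hz
    rw [onWord_eq_oddConj hψ]
    have h1 := (centerStep_nil_zero (m := m) (s := s) (j := (t - 1) / 2) (by omega)).lift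
      hm ht hs (by omega) (x := z) (by simpa using hz)
    have h2 := lift_iterate hm ht hs h1 (b := m - 1) (by omega)
    have h3 := (centerStep_last (t := t) (s := s) (a := ⟨m - 1, by omega⟩) (by simp; omega)
      (j := (s + t) / 2) (by omega)).lift hm ht hs (by omega) h2
    simpa [oddConj] using h3
  · intro N
    -- The bounds are chosen backwards along the cycle: for 0 ← ε, then for m-1 ← ⋯ ← 0, then for ε
    -- ← m-1.
    obtain ⟨N₁, h₁⟩ := exists_desubstitution hm ht hs hst N
    obtain ⟨N₂, h₂⟩ := exists_desubstitution_iterate hm ht hs hst (b := m - 1) (by omega) N₁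
    obtain ⟨N₃, h₃⟩ := exists_desubstitution hm ht hs hst N₂
    refine ⟨N₃, fun z hz hzu => ?_⟩
    obtain ⟨d, j, x, r, hd, -, hstep, hx, hxu, rfl⟩ := h₃ z [] (by simp) hz (by simpa using hzu)
    rcases hstep.of_nil hd with ⟨-, h⟩ | ⟨a, rfl, ha, h⟩
    · omega
    obtain rfl : j = (s + t) / 2 := by omega
    rw [show a = ⟨m - 1, by omega⟩ from Fin.ext (by simp; omega)] at hxu
    obtain ⟨y, r₂, hy, hyu, rfl⟩ := h₂ x hx hxu
    obtain ⟨d, j, x', r₃, hd, -, hstep, hx', hxu', rfl⟩ := h₁ y [0] (by simp) hy hyu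
    rcases hstep.of_singleton hd with ⟨rfl, -, h⟩ | ⟨a, -, h, -⟩ | ⟨-, h⟩
    · obtain rfl : j = (t - 1) / 2 := by omega
      refine ⟨r ++ (phiConj m t s ((s + t) / 2)).onWord
        (r₂ ++ (phiConj m t s t).iter (m - 1) r₃), x', hx', by simpa using hxu', ?_⟩
      rw [onWord_eq_oddConj hψ, oddConj]
      simp only [onWord_append, iter_append, List.append_assoc]
    · simp at h
    · omega

theorem phiConj_half_isPal (het : Even t) (a : Fin m) : IsPal (phiConj m t s (t / 2) a) := by
  rw [Nat.even_iff] at het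
  unfold IsPal phiConj
  split
  · simp only [List.reverse_append, List.reverse_replicate, List.reverse_singleton]
    rw [show t - t / 2 = t / 2 by omega, List.append_assoc]
  · simp

end lang

/-! ### Palindromic images and reversal -/

section general

variable {A : Type*}

/-- A morphism whose letter images are palindromes commutes with reversal. -/
theorem isImageRight_reversal {ψ : Morphism A} (hψ : ∀ a, IsPal (ψ a)) {v : LeftWord A}
    (h : IsImageLeft ψ v v) : IsImageRight ψ v.reversal v.reversal := by
  have hpre : ∀ n, v.reversal.pre n = (v.suf n).reverse := fun n => by
    rw [suf_eq_reverse_pre, List.reverse_reverse]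
    rfl
  have himg : ∀ n, ψ.onWord (v.reversal.pre n) = (ψ.onWord (v.suf n)).reverse := fun n => by
    rw [hpre, onWord_reverse hψ]
  refine ⟨fun n => ?_, fun N => ?_⟩
  · rw [himg, List.length_reverse, hpre, ← h.1 n]
  · obtain ⟨n, hn⟩ := h.2 N
    exact ⟨n, by rw [himg, List.length_reverse]; exact hn⟩

theorem leftQuot_append (x y : List A) : leftQuot x (x ++ y) = y := by
  simp [leftQuot]

end general

end PalBranch

/-! ### The theorem -/

open PalBranch in
theorem mainTheorem6 (m t s : ℕ) [NeZero m] (hm : 2 ≤ m) (hs : 1 ≤ s) (hst : s ≤ t) :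
    ((Even t ∨ (Odd t ∧ Odd s)) →
      ∃! v : PalBranch.LeftWord (Fin m),
        PalBranch.IsEmptyCenterBranch (PalBranch.uBeta m t s) v) ∧
    ∀ v : PalBranch.LeftWord (Fin m),
      PalBranch.IsEmptyCenterBranch (PalBranch.uBeta m t s) v →
      (Even t →
        ∀ w : List (Fin m), w = List.replicate (t / 2) 0 →
        ∀ ψ : PalBranch.Morphism (Fin m),
          (∀ a, ψ a = PalBranch.leftQuot w (PalBranch.phi m t s a ++ w)) →
        (∀ a, w <+: PalBranch.phi m t s a ++ w) ∧
        PalBranch.IsSubstitution ψ ∧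
        PalBranch.IsImageLeft ψ v v ∧
        (∀ a, PalBranch.IsPal (ψ a)) ∧
        PalBranch.IsImagePointed ψ
          (PalBranch.pointed v v.reversal) (PalBranch.pointed v v.reversal)) ∧
      (Odd t → Odd s →
        ∀ w : List (Fin m),
          w = (PalBranch.phi m t s).iter m (List.replicate ((t + 1) / 2) 0) ++
            List.replicate ((t - s) / 2) 0 →
        ∀ ψ : PalBranch.Morphism (Fin m),
          (∀ a, ψ a = PalBranch.leftQuot w ((PalBranch.phi m t s).iter (m + 1) [a] ++ w)) →
        (∀ a, w <+: (PalBranch.phi m t s).iter (m + 1) [a] ++ w) ∧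
        PalBranch.IsSubstitution ψ ∧
        PalBranch.IsImageLeft ψ v v) := by
  have ht : 1 ≤ t := hs.trans hst
  refine ⟨fun h => ?_, fun v hv => ⟨?_, ?_⟩⟩
  · rcases h with het | ⟨hot, hos⟩
    · obtain ⟨v, hv, -, huniq⟩ := existsUnique_branch_of_even hm hs hst het
      exact ⟨v, hv, huniq⟩
    · obtain ⟨v, hv, -, huniq⟩ :=
        existsUnique_branch_of_odd hm hs hst hot hos (fun a => rfl)
      exact ⟨v, hv, huniq⟩
  · rintro het w rfl ψ hψ
    have hconj : ∀ a, phi m t s a ++ List.replicate (t / 2) 0 =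
        List.replicate (t / 2) 0 ++ phiConj m t s (t / 2) a := fun a => by
      rw [← onWord_singleton (phi m t s), phiConj_conj (by omega), onWord_singleton]
    obtain rfl : ψ = phiConj m t s (t / 2) := by
      funext a
      rw [hψ, hconj, leftQuot_append]
    -- The fixed branch is the given one by uniqueness, so v inherits invariance.
    obtain ⟨v₀, -, himg, huniq⟩ := existsUnique_branch_of_even hm hs hst het
    obtain rfl := huniq v hv
    refine ⟨fun a => ?_, ?_, himg, phiConj_half_isPal het,
      himg, isImageRight_reversal (phiConj_half_isPal het) himg⟩
    · rw [hconj]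
      exact List.prefix_append _ _
    · exact isSubstitution_of_zero (phiConj_ne_nil hs _) (phiConj_zero_eq_cons hm (by omega))
        (phiConj_zero_length hm ht (by omega))
  · rintro hot hos w rfl ψ hψ
    have hψ' : ∀ a, ψ a = oddConj m t s [a] := fun a => by
      rw [hψ, phi_iter_conj hm hst hot hos, leftQuot_append]
    obtain ⟨v₀, -, himg, huniq⟩ := existsUnique_branch_of_odd hm hs hst hot hos hψ'
    obtain rfl := huniq v hv
    refine ⟨fun a => ?_, ?_, himg⟩
    · rw [phi_iter_conj hm hst hot hos]
      exact List.prefix_append _ _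
    · refine isSubstitution_of_zero (fun a => ?_) ?_ ?_
      · rw [hψ']
        exact oddConj_ne_nil hs a
      · rw [hψ']
        exact oddConj_zero_eq_cons hm ht hs
      · rw [hψ']
        exact oddConj_zero_length hm ht hs
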